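/- Fix a countable set of propositional letters; the atomic formulae are these letters together with two distinguished atoms $\top,\bot$, and the formulae are built from atoms with $\land,\neg,\Box,\mathsf K$. As usual $\phi\to\psi$ is $\neg(\phi\land\neg\psi)$, $\Diamond=\neg\Box\neg$ and $\mathsf L=\neg\mathsf K\neg$. The system $\mathbf{MP}^*$ has as axioms all propositional tautologies, $(A\to\Box A)\land(\neg A\to\Box\neg A)$ for atomic $A$, the schemes $\Box(\phi\to\psi)\to(\Box\phi\to\Box\psi)$, $\Box\phi\to\phi$, $\Box\phi\to\Box\Box\phi$, $\mathsf K(\phi\to\psi)\to(\mathsf K\phi\to\mathsf K\psi)$, $\mathsf K\phi\to\phi$, $\mathsf K\phi\to\mathsf K\mathsf K\phi$, $\phi\to\mathsf K\mathsf L\phi$, $\mathsf K\Box\phi\to\Box\mathsf K\phi$, $\Diamond\Box\phi\to\Box\Diamond\phi$ and $$\Diamond(\mathsf K\phi\land\psi)\land\mathsf L\Diamond(\mathsf K\phi\land\chi)\to\Diamond(\mathsf K\Diamond\phi\land\Diamond\psi\land\mathsf L\Diamond\chi),$$ and as rules modus ponens and necessitation for $\mathsf K$ and for $\Box$. Let $S$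 be the set of maximal $\mathbf{MP}^*$-consistent sets of formulae, and for $s,t\in S$ put $sR_\Box t$ iff $\{\phi:\Box\phi\in s\}\subseteq t$, and $sR_{\mathsf K}t$ iff $\{\phi:\mathsf K\phi\in s\}\subseteq t$. Call $e\in S$ an ending point of $s\in S$ if $s'R_\Box e$ for every $s'\in S$ with $sR_\Box s'$. Let $X$ be the set of all ending points of members of $S$; for $s\in S$ let $U_s\subseteq X$ be the set of all ending points of those $t\in S$ with $tR_{\mathsf K}s$; let $\mathcal T=\{\emptyset\}\cup\{U_s:s\in S\}$, and for atomic $A$ let $i(A)=\{x\in X:A\in x\}$. For $x\in U\in\mathcal T$ define $x,U\models\phi$ recursively: $x,U\models A$ iff $x\in i(A)$; $\land$ and $\neg$ are interpreted classically; $x,U\models\mathsf K\phi$ iff $y,U\models\phi$ for all $y\in U$; and $x,U\models\Box\phi$ iff $x,V\models\phi$ for all $V\in\mathcal T$ with $x\in V\subseteq U$. **Theorem.** $\mathcal T$ is the family of closed sets of a topology on $X$ (the canonical closed topology of $\mathbf{MP}^*$), and there is a bijection from the pointed product $X\dot\times\mathcal T=\{(x,U):U\in\mathcal T,\ x\in U\}$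 onto the set of ultrafilters (maximal proper filters) of the Lindenbaum algebra of $\mathbf{MP}^*$ (the Boolean algebra of formulae modulo provable equivalence), namely the map $(x,U)\mapsto\{[\phi]:x,U\models\phi\}$. -/

import Mathlib

namespace MPStar

/-! ### The language -/

/-- Atomic formulae: propositional letters from `P` and the two distinguished atoms `⊤`, `⊥`. -/
inductive Atom (P : Type*) where
  | top : Atom P
  | bot : Atom P
  | letter : P → Atom P

/-- The bimodal propositional language: atoms, `∧`, `¬`, `□` (effort) and `K` (knowledge). -/
inductive Formula (P : Type*) where
  | atom : Atom P → Formula P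
  | and : Formula P → Formula P → Formula P
  | neg : Formula P → Formula P
  | box : Formula P → Formula P
  | know : Formula P → Formula P

namespace Formula

variable {P : Type*}

/-- The formula `⊤`. -/
def top : Formula P := atom Atom.top

/-- The formula `⊥`. -/
def bot : Formula P := atom Atom.bot

/-- `φ ∨ ψ`. -/
def or (φ ψ : Formula P) : Formula P := neg (and (neg φ) (neg ψ))

/-- `φ → ψ`. -/
def imp (φ ψ : Formula P) : Formula P := neg (and φ (neg ψ))

/-- `◇ φ`. -/
def dia (φ : Formula P) : Formula P := neg (box (neg φ))

/-- `L φ`. -/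
def poss (φ : Formula P) : Formula P := neg (know (neg φ))

/-- The conjunction of a finite list of formulae (`⊤` for the empty list). -/
def conj : List (Formula P) → Formula P
  | [] => top
  | φ :: l => and φ (conj l)

/-- A truth assignment that respects the propositional connectives; letters and formulae of the
form `□ φ`, `K φ` may receive arbitrary truth values. -/
structure IsPropVal (v : Formula P → Prop) : Prop where
  top : v top
  bot : ¬ v bot
  neg : ∀ φ, v (neg φ) ↔ ¬ v φ
  and : ∀ φ ψ, v (and φ ψ) ↔ v φ ∧ v ψ

/-- (Substitution instances of) propositional tautologies. -/
def Tautology (φ : Formula P) : Prop := ∀ v : Formula P → Prop, IsPropVal v → v φ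

end Formula

open Formula in
/-- Theorems of the system `MP*`. -/
inductive Provable {P : Type*} : Formula P → Prop
  | taut (φ : Formula P) : Tautology φ → Provable φ
  | atomPersistent (A : Atom P) :
      Provable (and (imp (atom A) (box (atom A))) (imp (neg (atom A)) (box (neg (atom A)))))
  | boxDistr (φ ψ : Formula P) : Provable (imp (box (imp φ ψ)) (imp (box φ) (box ψ)))
  | boxT (φ : Formula P) : Provable (imp (box φ) φ)
  | boxFour (φ : Formula P) : Provable (imp (box φ) (box (box φ)))
  | knowDistr (φ ψ : Formula P) : Provable (imp (know (imp φ ψ)) (imp (know φ) (know ψ)))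
  | knowT (φ : Formula P) : Provable (imp (know φ) φ)
  | knowFour (φ : Formula P) : Provable (imp (know φ) (know (know φ)))
  | knowB (φ : Formula P) : Provable (imp φ (know (poss φ)))
  | knowBox (φ : Formula P) : Provable (imp (know (box φ)) (box (know φ)))
  | diaBox (φ : Formula P) : Provable (imp (dia (box φ)) (box (dia φ)))
  | union (φ ψ χ : Formula P) : Provable
      (imp (and (dia (and (know φ) ψ)) (poss (dia (and (know φ) χ))))
        (dia (and (and (know (dia φ)) (dia ψ)) (poss (dia χ)))))
  | mp (φ ψ : Formula P) : Provable (imp φ ψ) → Provable φ → Provable ψ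
  | knowNec (φ : Formula P) : Provable φ → Provable (know φ)
  | boxNec (φ : Formula P) : Provable φ → Provable (box φ)

/-! ### Subset space semantics -/

section Semantics

variable {P X : Type*}

/-- The pointed product `X ×̇ 𝒪` of a set `X` and a family `𝒪` of subsets of `X`:
the pairs `(x, U)` with `U ∈ 𝒪` and `x ∈ U`. -/
def PointedProduct (𝒪 : Set (Set X)) : Type _ := {p : X × Set X // p.2 ∈ 𝒪 ∧ p.1 ∈ p.2}

/-- `Sat 𝒪 i φ x U` is the satisfaction relation `x, U ⊨ φ` of `⟨X, 𝒪, i⟩`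
(meaningful for `x ∈ U ∈ 𝒪`). -/
def Sat (𝒪 : Set (Set X)) (i : Atom P → Set X) : Formula P → X → Set X → Prop
  | .atom A, x, _ => x ∈ i A
  | .and φ ψ, x, U => Sat 𝒪 i φ x U ∧ Sat 𝒪 i ψ x U
  | .neg φ, x, U => ¬ Sat 𝒪 i φ x U
  | .box φ, x, U => ∀ V ∈ 𝒪, V ⊆ U → x ∈ V → Sat 𝒪 i φ x V
  | .know φ, _, U => ∀ y ∈ U, Sat 𝒪 i φ y U

end Semantics

/-! ### The canonical model and the canonical closed topology -/

section Canonical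

variable {P : Type*}

/-- `Γ` is `MP*`-consistent: no finite conjunction of members of `Γ` is refutable. -/
def Consistent (Γ : Set (Formula P)) : Prop :=
  ∀ l : List (Formula P), (∀ φ ∈ l, φ ∈ Γ) → ¬ Provable (Formula.neg (Formula.conj l))

variable (P) in
/-- The domain of the canonical model: the maximal consistent sets of formulae. -/
def World : Type _ := {s : Set (Formula P) // Maximal Consistent s}

/-- The accessibility relation `R_□` of the canonical model. -/
def RBox (s t : World P) : Prop := ∀ φ : Formula P, Formula.box φ ∈ s.1 → φ ∈ t.1

/-- The accessibility relation `R_K` of the canonical model. -/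
def RKnow (s t : World P) : Prop := ∀ φ : Formula P, Formula.know φ ∈ s.1 → φ ∈ t.1

/-- `e` is the ending point of `s`: every `R_□`-successor of `s` sees `e`. -/
def IsEndingPoint (s e : World P) : Prop := ∀ s' : World P, RBox s s' → RBox s' e

variable (P) in
/-- The points of the canonical topology: the ending points of members of the canonical model. -/
def CanonicalPoint : Type _ := {e : World P // ∃ s : World P, IsEndingPoint s e}

/-- The set `U_s` of the ending points of the worlds that are `R_K`-equivalent to `s`. -/
def canonicalSet (s : World P) : Set (CanonicalPoint P) :=
  {x | ∃ t : World P, RKnow t s ∧ IsEndingPoint t x.1}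

variable (P) in
/-- The canonical topology, as a family of closed sets: the sets `U_s` and the empty set. -/
def canonicalTopology : Set (Set (CanonicalPoint P)) :=
  {U | U = ∅ ∨ ∃ s : World P, U = canonicalSet s}

variable (P) in
/-- The initial interpretation of the canonical subset model. -/
def canonicalInterp (A : Atom P) : Set (CanonicalPoint P) := {x | Formula.atom A ∈ x.1.1}

end Canonical

/-! ### The canonical (Lindenbaum) algebra and its ultrafilters -/

section Lindenbaum

variable {P : Type*}

open Formula

/-- Modus ponens for propositional consequences of one theorem. -/
theorem Provable.of_taut {φ ψ : Formula P} (h : Provable φ)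
    (ht : ∀ v : Formula P → Prop, IsPropVal v → v φ → v ψ) : Provable ψ := by
  refine Provable.mp φ ψ (Provable.taut _ fun v hv => ?_) h
  have := ht v hv
  simp only [imp, hv.neg, hv.and]
  tauto

/-- Modus ponens for propositional consequences of two theorems. -/
theorem Provable.of_taut₂ {φ ψ χ : Formula P} (h₁ : Provable φ) (h₂ : Provable ψ)
    (ht : ∀ v : Formula P → Prop, IsPropVal v → v φ → v ψ → v χ) : Provable χ := by
  refine Provable.mp ψ χ (h₁.of_taut fun v hv h => ?_) h₂
  have := ht v hv h
  simp only [imp, hv.neg, hv.and]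
  tauto

theorem Formula.IsPropVal.imp {v : Formula P → Prop} (hv : IsPropVal v) (φ ψ : Formula P) :
    v (φ.imp ψ) ↔ (v φ → v ψ) := by
  simp only [Formula.imp, hv.neg, hv.and]; tauto

theorem Formula.IsPropVal.or {v : Formula P → Prop} (hv : IsPropVal v) (φ ψ : Formula P) :
    v (φ.or ψ) ↔ (v φ ∨ v ψ) := by
  simp only [Formula.or, hv.neg, hv.and]; tauto

/-- Formulae preordered by provable implication. -/
instance formulaPreorder : Preorder (Formula P) where
  le φ ψ := Provable (imp φ ψ)
  le_refl φ := Provable.taut _ fun v hv => (hv.imp _ _).2 id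
  le_trans φ ψ χ h₁ h₂ := h₁.of_taut₂ h₂ fun v hv => by
    simp only [hv.imp]; tauto

variable (P) in
/-- The Lindenbaum algebra of `MP*`: formulae modulo provable equivalence, ordered by provable
implication. -/
def Lindenbaum : Type _ := Antisymmetrization (Formula P) (· ≤ ·)

/-- The class of a formula in the Lindenbaum algebra. -/
def Lindenbaum.mk (φ : Formula P) : Lindenbaum P := toAntisymmetrization (· ≤ ·) φ

instance Lindenbaum.partialOrder : PartialOrder (Lindenbaum P) :=
  inferInstanceAs (PartialOrder (Antisymmetrization (Formula P) (· ≤ ·)))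

theorem Lindenbaum.mk_le_mk {φ ψ : Formula P} :
    Lindenbaum.mk φ ≤ Lindenbaum.mk ψ ↔ Provable (imp φ ψ) := Iff.rfl

theorem Lindenbaum.mk_eq_mk {φ ψ : Formula P} :
    Lindenbaum.mk φ = Lindenbaum.mk ψ ↔ Provable (imp φ ψ) ∧ Provable (imp ψ φ) := by
  rw [← Lindenbaum.mk_le_mk, ← Lindenbaum.mk_le_mk]
  exact le_antisymm_iff

theorem Lindenbaum.ind {p : Lindenbaum P → Prop} (h : ∀ φ, p (Lindenbaum.mk φ))
    (a : Lindenbaum P) : p a := Quotient.inductionOn' a h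

/-- Conjunction on classes. -/
def Lindenbaum.inf (a b : Lindenbaum P) : Lindenbaum P :=
  Quotient.liftOn₂' a b (fun φ ψ => Lindenbaum.mk (Formula.and φ ψ))
    (fun φ₁ ψ₁ φ₂ ψ₂ h h' => Lindenbaum.mk_eq_mk.2
      ⟨Provable.of_taut₂ h.1 h'.1 fun v hv => by simp only [hv.imp, hv.and]; tauto,
       Provable.of_taut₂ h.2 h'.2 fun v hv => by simp only [hv.imp, hv.and]; tauto⟩)

/-- Disjunction on classes. -/
def Lindenbaum.sup (a b : Lindenbaum P) : Lindenbaum P :=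
  Quotient.liftOn₂' a b (fun φ ψ => Lindenbaum.mk (Formula.or φ ψ))
    (fun φ₁ ψ₁ φ₂ ψ₂ h h' => Lindenbaum.mk_eq_mk.2
      ⟨Provable.of_taut₂ h.1 h'.1 fun v hv => by simp only [hv.imp, hv.or]; tauto,
       Provable.of_taut₂ h.2 h'.2 fun v hv => by simp only [hv.imp, hv.or]; tauto⟩)

/-- Negation on classes. -/
def Lindenbaum.compl (a : Lindenbaum P) : Lindenbaum P :=
  Quotient.liftOn' a (fun φ => Lindenbaum.mk (Formula.neg φ))
    (fun φ₁ φ₂ h => Lindenbaum.mk_eq_mk.2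
      ⟨Provable.of_taut h.2 fun v hv => by simp only [hv.imp, hv.neg]; tauto,
       Provable.of_taut h.1 fun v hv => by simp only [hv.imp, hv.neg]; tauto⟩)

/-- The Boolean algebra structure of the Lindenbaum algebra. -/
instance Lindenbaum.booleanAlgebra : BooleanAlgebra (Lindenbaum P) where
  sup := Lindenbaum.sup
  inf := Lindenbaum.inf
  compl := Lindenbaum.compl
  top := Lindenbaum.mk Formula.top
  bot := Lindenbaum.mk Formula.bot
  le_sup_left a b := by
    induction a using Lindenbaum.ind; induction b using Lindenbaum.ind
    exact Provable.taut _ fun v hv => by simp only [hv.imp, hv.or]; tauto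
  le_sup_right a b := by
    induction a using Lindenbaum.ind; induction b using Lindenbaum.ind
    exact Provable.taut _ fun v hv => by simp only [hv.imp, hv.or]; tauto
  sup_le a b c := by
    induction a using Lindenbaum.ind; induction b using Lindenbaum.ind
    induction c using Lindenbaum.ind
    exact fun h h' => Provable.of_taut₂ h h' fun v hv => by simp only [hv.imp, hv.or]; tauto
  inf_le_left a b := by
    induction a using Lindenbaum.ind; induction b using Lindenbaum.ind
    exact Provable.taut _ fun v hv => by simp only [hv.imp, hv.and]; tauto
  inf_le_right a b := by
    induction a using Lindenbaum.ind; induction b using Lindenbaum.ind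
    exact Provable.taut _ fun v hv => by simp only [hv.imp, hv.and]; tauto
  le_inf a b c := by
    induction a using Lindenbaum.ind; induction b using Lindenbaum.ind
    induction c using Lindenbaum.ind
    exact fun h h' => Provable.of_taut₂ h h' fun v hv => by simp only [hv.imp, hv.and]; tauto
  le_sup_inf a b c := by
    induction a using Lindenbaum.ind; induction b using Lindenbaum.ind
    induction c using Lindenbaum.ind
    exact Provable.taut _ fun v hv => by
      simp only [hv.imp, hv.and, hv.or]; tauto
  inf_compl_le_bot a := by
    induction a using Lindenbaum.ind
    exact Provable.taut _ fun v hv => by simp only [hv.imp, hv.and, hv.neg]; tauto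
  top_le_sup_compl a := by
    induction a using Lindenbaum.ind
    exact Provable.taut _ fun v hv => by simp only [hv.imp, hv.or, hv.neg]; tauto
  le_top a := by
    induction a using Lindenbaum.ind
    exact Provable.taut _ fun v hv => (hv.imp _ _).2 fun _ => hv.top
  bot_le a := by
    induction a using Lindenbaum.ind
    exact Provable.taut _ fun v hv => (hv.imp _ _).2 fun h => (hv.bot h).elim

end Lindenbaum

/-- The ultrafilters of a Boolean algebra: its maximal proper filters. -/
def BoolUltrafilter (B : Type*) [BooleanAlgebra B] : Type _ :=
  {F : Order.PFilter B // Maximal (fun G : Order.PFilter B => ⊥ ∉ G) F}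

end MPStar

namespace MPStar

open Formula

variable {P : Type*}

/-! ### Maximal consistent sets -/

/-! The proof rests on persistent formulae, whose truth value is constant along `RBox`. Atoms are
persistent, Boolean combinations stay so, and ◇Kφ is persistent when φ is (`Persistent.dia_know`).
The union axiom, iterated and combined with compactness, yields `exists_rBox_know_poss`: a successor
that knows prescribed persistent formulae and keeps others possible. Hence agreement on persistent
formulae and on knowledge of them is a bisimulation, and therefore equality (`Agree.eq`).

The ending point of `s` records the persistent formulae true at `s`, and `canonicalSet s` records
the persistent formulae known at `s`. So worlds are the same as pointed pairs. Under this
correspondence `RBox` shrinks the set and fixes the point (`rBox_iff`), while `RKnow` moves the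
point within the set, which gives the truth lemma `sat_endpoint_iff`. Worlds are also the same as
ultrafilters of the Lindenbaum algebra, and the required bijection is the composite.

For the topology, the canonical sets are identified with the saturated sets, a class visibly stable
under finite unions and arbitrary intersections. Below a canonical set every saturated set is
canonical, again by `exists_rBox_know_poss`; it remains to see that the whole space is canonical.
Soundness needs only bounded unions and intersections, so it holds in a disjoint sum of copies of
the canonical model, one for each world. The set with fibre `canonicalSet s` over each `s` contains
a copy of every point, and the theory of one of its points is a world whose canonical set is
everything. -/

theorem Formula.IsPropVal.conj {v : Formula P → Prop} (hv : IsPropVal v) (l : List (Formula P)) :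
    v (Formula.conj l) ↔ ∀ φ ∈ l, v φ := by
  induction l with
  | nil => simpa [Formula.conj] using hv.top
  | cons a l ih => simp [Formula.conj, hv.and, ih]

theorem exists_maximal_consistent {Γ : Set (Formula P)} (h : Consistent Γ) :
    ∃ s : World P, Γ ⊆ s.1 := by
  obtain ⟨m, hm, hmax⟩ := zorn_subset_nonempty {Δ : Set (Formula P) | Consistent Δ} (by
    intro c hc hchain hne
    refine ⟨⋃₀ c, ?_, fun s hs => Set.subset_sUnion_of_mem hs⟩
    intro l hl
    have : ∃ Δ ∈ c, ∀ φ ∈ l, φ ∈ Δ := by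
      induction l with
      | nil => exact ⟨hne.some, hne.some_mem, by simp⟩
      | cons a l ih =>
        obtain ⟨Δ, hΔ, h1⟩ := ih fun φ hφ => hl φ (List.mem_cons_of_mem _ hφ)
        obtain ⟨Δ', hΔ', h2⟩ := hl a List.mem_cons_self
        rcases hchain.total hΔ hΔ' with h3 | h3
        · exact ⟨Δ', hΔ', List.forall_mem_cons.2 ⟨h2, fun φ hφ => h3 (h1 φ hφ)⟩⟩
        · exact ⟨Δ, hΔ, List.forall_mem_cons.2 ⟨h3 h2, h1⟩⟩
    obtain ⟨Δ, hΔ, h1⟩ := this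
    exact hc hΔ l h1) Γ h
  exact ⟨⟨m, hmax⟩, hm⟩

/-- If `φ` cannot be added consistently to `Γ`, finitely many members of `Γ` refute it. -/
theorem exists_refutation {Γ : Set (Formula P)} {φ : Formula P}
    (h : ¬ Consistent (insert φ Γ)) :
    ∃ l : List (Formula P), (∀ ψ ∈ l, ψ ∈ Γ) ∧ Provable (imp (conj l) (neg φ)) := by
  classical
  simp only [Consistent, not_forall, not_not] at h
  obtain ⟨l, hl, hp⟩ := h
  refine ⟨l.filter (· ≠ φ), fun ψ hψ => ?_, hp.of_taut fun v hv => ?_⟩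
  · simp only [List.mem_filter, decide_eq_true_eq] at hψ
    exact (hl ψ hψ.1).resolve_left hψ.2
  · simp only [hv.neg, hv.imp, hv.conj, List.mem_filter, decide_eq_true_eq]
    intro h1 h2 h3
    refine h1 fun ψ hψ => ?_
    by_cases h4 : ψ = φ
    · exact h4 ▸ h3
    · exact h2 ψ ⟨hψ, h4⟩

theorem World.mem_of_conj (s : World P) {l : List (Formula P)} {φ : Formula P}
    (hl : ∀ ψ ∈ l, ψ ∈ s.1) (h : Provable (imp (conj l) φ)) : φ ∈ s.1 := by
  by_contra hφ
  have hc : ¬ Consistent (insert φ s.1) := fun hc =>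
    hφ (s.2.2 hc (Set.subset_insert _ _) (Set.mem_insert _ _))
  obtain ⟨l', hl', h'⟩ := exists_refutation hc
  refine s.2.1 (l ++ l') (fun ψ hψ => ?_) (h.of_taut₂ h' fun v hv => ?_)
  · rcases List.mem_append.1 hψ with h | h
    exacts [hl ψ h, hl' ψ h]
  · simp only [hv.imp, hv.neg, hv.conj, List.mem_append]
    exact fun h1 h2 h3 => h2 (fun ψ hψ => h3 ψ (.inr hψ)) (h1 fun ψ hψ => h3 ψ (.inl hψ))

theorem World.mem_of_provable (s : World P) {φ : Formula P} (h : Provable φ) : φ ∈ s.1 :=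
  s.mem_of_conj (l := []) (by simp) (h.of_taut fun v hv => by
    simp only [hv.imp]; exact fun h _ => h)

theorem World.isPropVal (s : World P) : IsPropVal (· ∈ s.1) where
  top := s.mem_of_provable (.taut _ fun _ hv => hv.top)
  bot h := s.2.1 [bot] (by simpa using h) (.taut _ fun v hv => by
    simp only [hv.neg, hv.conj]; exact fun h => hv.bot (h _ (by simp)))
  neg φ := by
    constructor
    · intro h1 h2
      refine s.2.1 [φ, neg φ] (by simp [h1, h2]) (.taut _ fun v hv => ?_)
      simp only [hv.neg, hv.conj, List.mem_cons, List.not_mem_nil, or_false, forall_eq_or_imp,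
        forall_eq]
      tauto
    · intro h
      have hc : ¬ Consistent (insert φ s.1) := fun hc =>
        h (s.2.2 hc (Set.subset_insert _ _) (Set.mem_insert _ _))
      obtain ⟨l, hl, h'⟩ := exists_refutation hc
      exact s.mem_of_conj hl h'
  and φ ψ := by
    constructor
    · intro h
      have := fun χ => s.mem_of_conj (l := [and φ ψ]) (φ := χ) (by simpa using h)
      constructor <;> refine this _ (.taut _ fun v hv => ?_) <;>
      · simp only [hv.imp, hv.conj, hv.and, List.mem_singleton, forall_eq]
        tauto
    · rintro ⟨h1, h2⟩
      refine s.mem_of_conj (l := [φ, ψ]) (by simp [h1, h2]) (.taut _ fun v hv => ?_)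
      simp [hv.imp, hv.conj, hv.and]

@[simp] theorem World.mem_neg {s : World P} {φ : Formula P} : neg φ ∈ s.1 ↔ φ ∉ s.1 :=
  s.isPropVal.neg φ

@[simp] theorem World.mem_and {s : World P} {φ ψ : Formula P} :
    and φ ψ ∈ s.1 ↔ φ ∈ s.1 ∧ ψ ∈ s.1 := s.isPropVal.and φ ψ

@[simp] theorem World.mem_imp {s : World P} {φ ψ : Formula P} :
    imp φ ψ ∈ s.1 ↔ (φ ∈ s.1 → ψ ∈ s.1) := s.isPropVal.imp φ ψ

@[simp] theorem World.mem_or {s : World P} {φ ψ : Formula P} :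
    or φ ψ ∈ s.1 ↔ (φ ∈ s.1 ∨ ψ ∈ s.1) := s.isPropVal.or φ ψ

@[simp] theorem World.mem_conj {s : World P} {l : List (Formula P)} :
    conj l ∈ s.1 ↔ ∀ φ ∈ l, φ ∈ s.1 := s.isPropVal.conj l

@[simp] theorem World.top_mem (s : World P) : top ∈ s.1 := s.isPropVal.top

@[simp] theorem World.bot_notMem (s : World P) : bot ∉ s.1 := s.isPropVal.bot

/-- A valuation that makes every theorem true determines a member of the canonical model. -/
def World.ofPropVal {v : Formula P → Prop} (hv : IsPropVal v) (h : ∀ φ, Provable φ → v φ) :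
    World P :=
  ⟨{φ | v φ}, fun l hl hp => (hv.neg _).1 (h _ hp) ((hv.conj l).2 hl), fun Δ hΔ hle φ hφ => by
    by_contra hn
    refine hΔ [φ, neg φ] ?_ (.taut _ fun w hw => ?_)
    · have : neg φ ∈ Δ := hle ((hv.neg φ).2 hn)
      simp [hφ, this]
    · simp only [hw.neg, hw.conj, List.mem_cons, List.not_mem_nil, or_false, forall_eq_or_imp,
        forall_eq]
      tauto⟩

theorem World.eq_of_subset {s t : World P} (h : s.1 ⊆ t.1) : s = t :=
  Subtype.ext (h.antisymm (s.2.2 t.2.1 h))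

/-- Completeness for the canonical model. -/
theorem provable_iff_forall_mem {φ : Formula P} : Provable φ ↔ ∀ s : World P, φ ∈ s.1 := by
  refine ⟨fun h s => s.mem_of_provable h, fun h => ?_⟩
  by_contra hn
  have hc : Consistent {neg φ} := fun l hl hp => hn (hp.of_taut fun v hv => by
    simp only [hv.neg, hv.conj]
    intro h1
    by_contra h2
    exact h1 fun ψ hψ => by rw [hl ψ hψ]; exact (hv.neg _).2 h2)
  obtain ⟨s, hs⟩ := exists_maximal_consistent hc
  exact World.mem_neg.1 (hs rfl) (h s)

/-- The existence lemma for a normal modality `m`, for a conjunctively closed set of formulae. -/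
theorem exists_world_of_normal (m : Formula P → Formula P)
    (distr : ∀ φ ψ, Provable (imp (m (imp φ ψ)) (imp (m φ) (m ψ))))
    (nec : ∀ φ, Provable φ → Provable (m φ)) (s : World P) {D : Set (Formula P)}
    (htop : top ∈ D) (hand : ∀ φ ∈ D, ∀ ψ ∈ D, and φ ψ ∈ D)
    (h : ∀ φ ∈ D, m (neg φ) ∉ s.1) :
    ∃ t : World P, (∀ φ, m φ ∈ s.1 → φ ∈ t.1) ∧ D ⊆ t.1 := by
  have hmono : ∀ φ ψ, Provable (imp φ ψ) → m φ ∈ s.1 → m ψ ∈ s.1 := fun φ ψ hp hφ =>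
    World.mem_imp.1 (World.mem_imp.1 (s.mem_of_provable (distr φ ψ))
      (s.mem_of_provable (nec _ hp))) hφ
  have key : ∀ l : List (Formula P), (∀ φ ∈ l, φ ∈ {φ | m φ ∈ s.1} ∪ D) →
      ∃ γ δ, m γ ∈ s.1 ∧ δ ∈ D ∧ Provable (imp (and γ δ) (conj l)) := by
    intro l
    induction l with
    | nil =>
      exact fun _ => ⟨top, top, s.mem_of_provable (nec _ (.taut _ fun v hv => hv.top)), htop,
        .taut _ fun v hv => by simp [hv.imp, hv.conj]⟩
    | cons a l ih =>
      intro hl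
      obtain ⟨γ, δ, hγ, hδ, hp⟩ := ih fun φ hφ => hl φ (List.mem_cons_of_mem _ hφ)
      rcases hl a List.mem_cons_self with ha | ha
      · refine ⟨and a γ, δ, ?_, hδ, hp.of_taut fun v hv => ?_⟩
        · have h1 : m (imp γ (and a γ)) ∈ s.1 := hmono a _ (.taut _ fun v hv => by
            simp only [hv.imp, hv.and]; tauto) ha
          exact World.mem_imp.1 (World.mem_imp.1 (s.mem_of_provable (distr _ _)) h1) hγ
        · simp only [hv.imp, hv.and, conj]; tauto
      · refine ⟨γ, and a δ, hγ, hand _ ha _ hδ, hp.of_taut fun v hv => ?_⟩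
        simp only [hv.imp, hv.and, conj]; tauto
  have hc : Consistent ({φ | m φ ∈ s.1} ∪ D) := by
    intro l hl hp
    obtain ⟨γ, δ, hγ, hδ, hq⟩ := key l hl
    refine h δ hδ (hmono γ _ (hp.of_taut₂ hq fun v hv => ?_) hγ)
    simp only [hv.imp, hv.and, hv.neg]; tauto
  obtain ⟨t, ht⟩ := exists_maximal_consistent hc
  exact ⟨t, fun φ hφ => ht (.inl hφ), fun φ hφ => ht (.inr hφ)⟩

theorem exists_rBox (s : World P) {D : Set (Formula P)} (htop : top ∈ D)
    (hand : ∀ φ ∈ D, ∀ ψ ∈ D, and φ ψ ∈ D) (h : ∀ φ ∈ D, dia φ ∈ s.1) :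
    ∃ t, RBox s t ∧ D ⊆ t.1 :=
  exists_world_of_normal box .boxDistr .boxNec s htop hand fun φ hφ => World.mem_neg.1 (h φ hφ)

theorem exists_rKnow (s : World P) {D : Set (Formula P)} (htop : top ∈ D)
    (hand : ∀ φ ∈ D, ∀ ψ ∈ D, and φ ψ ∈ D) (h : ∀ φ ∈ D, poss φ ∈ s.1) :
    ∃ t, RKnow s t ∧ D ⊆ t.1 :=
  exists_world_of_normal know .knowDistr .knowNec s htop hand fun φ hφ => World.mem_neg.1 (h φ hφ)

/-- The consequences of one formula are closed under conjunction, so the general existence lemma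
applies to them. -/
theorem exists_world_of_normal_single (m : Formula P → Formula P)
    (distr : ∀ φ ψ, Provable (imp (m (imp φ ψ)) (imp (m φ) (m ψ))))
    (nec : ∀ φ, Provable φ → Provable (m φ)) (s : World P) {φ : Formula P}
    (h : m (neg φ) ∉ s.1) : ∃ t : World P, (∀ φ, m φ ∈ s.1 → φ ∈ t.1) ∧ φ ∈ t.1 := by
  obtain ⟨t, h1, h2⟩ := exists_world_of_normal m distr nec s
    (D := {ψ | Provable (imp φ ψ)}) (.taut _ fun v hv => by
      rw [hv.imp]; exact fun _ => hv.top)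
    (fun ψ hψ χ hχ => hψ.of_taut₂ hχ fun v hv => by simp only [hv.imp, hv.and]; tauto)
    (fun ψ hψ hm => h (World.mem_imp.1 (World.mem_imp.1 (s.mem_of_provable (distr _ _))
      (s.mem_of_provable (nec _ (Provable.of_taut hψ fun v hv => by
        simp only [hv.imp, hv.neg]; tauto)))) hm))
  exact ⟨t, h1, h2 (.taut _ fun v hv => (hv.imp _ _).2 id)⟩

theorem World.mem_dia {s : World P} {φ : Formula P} :
    dia φ ∈ s.1 ↔ ∃ t, RBox s t ∧ φ ∈ t.1 := by
  refine ⟨fun h => exists_world_of_normal_single box .boxDistr .boxNec s (mem_neg.1 h), ?_⟩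
  rintro ⟨t, h, ht⟩
  exact mem_neg.2 fun hb => mem_neg.1 (h _ hb) ht

theorem World.mem_poss {s : World P} {φ : Formula P} :
    poss φ ∈ s.1 ↔ ∃ t, RKnow s t ∧ φ ∈ t.1 := by
  refine ⟨fun h => exists_world_of_normal_single know .knowDistr .knowNec s (mem_neg.1 h), ?_⟩
  rintro ⟨t, h, ht⟩
  exact mem_neg.2 fun hb => mem_neg.1 (h _ hb) ht

theorem World.mem_box {s : World P} {φ : Formula P} :
    box φ ∈ s.1 ↔ ∀ t, RBox s t → φ ∈ t.1 := by
  refine ⟨fun h t ht => ht _ h, fun h => ?_⟩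
  by_contra hn
  have hd : dia (neg φ) ∈ s.1 := mem_neg.2 fun hb => hn
    (mem_imp.1 (mem_imp.1 (s.mem_of_provable (.boxDistr _ _)) (s.mem_of_provable
      (.boxNec _ (.taut _ fun v hv => by simp [hv.imp, hv.neg])))) hb)
  obtain ⟨t, h1, h2⟩ := mem_dia.1 hd
  exact mem_neg.1 h2 (h t h1)

theorem World.mem_know {s : World P} {φ : Formula P} :
    know φ ∈ s.1 ↔ ∀ t, RKnow s t → φ ∈ t.1 := by
  refine ⟨fun h t ht => ht _ h, fun h => ?_⟩
  by_contra hn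
  have hd : poss (neg φ) ∈ s.1 := mem_neg.2 fun hb => hn
    (mem_imp.1 (mem_imp.1 (s.mem_of_provable (.knowDistr _ _)) (s.mem_of_provable
      (.knowNec _ (.taut _ fun v hv => by simp [hv.imp, hv.neg])))) hb)
  obtain ⟨t, h1, h2⟩ := mem_poss.1 hd
  exact mem_neg.1 h2 (h t h1)

/-! ### The accessibility relations -/

theorem RBox.refl (s : World P) : RBox s s := fun φ h =>
  World.mem_imp.1 (s.mem_of_provable (.boxT φ)) h

theorem RBox.trans {s t u : World P} (h : RBox s t) (h' : RBox t u) : RBox s u := fun φ hφ =>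
  h' _ (h _ (World.mem_imp.1 (s.mem_of_provable (.boxFour φ)) hφ))

theorem RKnow.refl (s : World P) : RKnow s s := fun φ h =>
  World.mem_imp.1 (s.mem_of_provable (.knowT φ)) h

theorem RKnow.trans {s t u : World P} (h : RKnow s t) (h' : RKnow t u) : RKnow s u := fun φ hφ =>
  h' _ (h _ (World.mem_imp.1 (s.mem_of_provable (.knowFour φ)) hφ))

theorem RKnow.symm {s t : World P} (h : RKnow s t) : RKnow t s := fun φ hφ => by
  by_contra hn
  have h1 := h _ (World.mem_imp.1 (s.mem_of_provable (.knowB (neg φ))) (World.mem_neg.2 hn))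
  obtain ⟨u, hu, h2⟩ := World.mem_poss.1 h1
  exact World.mem_neg.1 h2 (hu _ hφ)

/-- Semantic form of K□φ → □Kφ: a □-step followed by a K-step can be taken in the opposite order. -/
theorem RBox.cross {s t u : World P} (h : RBox s t) (h' : RKnow t u) :
    ∃ v, RKnow s v ∧ RBox v u := by
  -- The formulae ◇ψ with ψ ∈ `u` are not closed under conjunction, but their consequences are,
  -- because ◇(ψ ∧ ψ') entails both ◇ψ and ◇ψ'.
  obtain ⟨v, h1, h2⟩ := exists_rKnow s (D := {φ | ∃ ψ, ψ ∈ u.1 ∧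
      ∀ v : World P, dia ψ ∈ v.1 → φ ∈ v.1}) ⟨top, by simp, by simp⟩ (by
    rintro φ ⟨ψ, h1, h2⟩ φ' ⟨ψ', h1', h2'⟩
    refine ⟨and ψ ψ', by simp [h1, h1'], fun v hv => ?_⟩
    obtain ⟨w, hw, hw'⟩ := World.mem_dia.1 hv
    rw [World.mem_and] at hw' ⊢
    exact ⟨h2 _ (World.mem_dia.2 ⟨w, hw, hw'.1⟩), h2' _ (World.mem_dia.2 ⟨w, hw, hw'.2⟩)⟩) (by
    rintro φ ⟨ψ, h1, h2⟩
    by_contra hn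
    have hk : know (box (neg ψ)) ∈ s.1 := World.mem_know.2 fun w hw => by
      by_contra hb
      exact hn (World.mem_poss.2 ⟨w, hw, h2 w (World.mem_neg.2 hb)⟩)
    have := World.mem_imp.1 (s.mem_of_provable (.knowBox _)) hk
    exact World.mem_neg.1 (h' _ (h _ this)) h1)
  refine ⟨v, h1, fun φ hφ => ?_⟩
  by_contra hn
  have : dia (neg φ) ∈ v.1 := h2 ⟨neg φ, World.mem_neg.2 hn, fun _ h => h⟩
  obtain ⟨w, hw, hw'⟩ := World.mem_dia.1 this
  exact World.mem_neg.1 hw' (hw _ hφ)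

/-! ### Persistent formulae -/

/-- `φ` is persistent if its truth value never changes along `R_□`. -/
def Persistent (φ : Formula P) : Prop := ∀ ⦃s t : World P⦄, RBox s t → (φ ∈ s.1 ↔ φ ∈ t.1)

theorem persistent_atom (A : Atom P) : Persistent (atom A) := fun s t h => by
  have := World.mem_and.1 (s.mem_of_provable (.atomPersistent A))
  simp only [World.mem_imp, World.mem_neg] at this
  refine ⟨fun h1 => h _ (this.1 h1), fun h1 => ?_⟩
  by_contra h2
  exact World.mem_neg.1 (h _ (this.2 h2)) h1

theorem Persistent.neg {φ : Formula P} (h : Persistent φ) : Persistent (neg φ) := fun s t hst => by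
  simp [h hst]

theorem Persistent.and {φ ψ : Formula P} (h : Persistent φ) (h' : Persistent ψ) :
    Persistent (and φ ψ) := fun s t hst => by
  simp [h hst, h' hst]

theorem Persistent.or {φ ψ : Formula P} (h : Persistent φ) (h' : Persistent ψ) :
    Persistent (or φ ψ) := fun s t hst => by
  simp [h hst, h' hst]

theorem Persistent.know_mem {φ : Formula P} (h : Persistent φ) {s t : World P} (hst : RBox s t)
    (hs : know φ ∈ s.1) : know φ ∈ t.1 :=
  World.mem_know.2 fun _ hu =>
    let ⟨_, hv, hvu⟩ := hst.cross hu
    (h hvu).1 (hv _ hs)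

theorem dia_mem_of_dia_box_mem {φ : Formula P} {s t : World P} (hst : RBox s t)
    (h : dia (box φ) ∈ s.1) : dia φ ∈ t.1 :=
  World.mem_box.1 (World.mem_imp.1 (s.mem_of_provable (.diaBox φ)) h) t hst

/-- Knowledge of a persistent formula is never lost, so ◇Kφ amounts to ◇□Kφ, and the axiom ◇□ → □◇
carries it to every successor. The converse is transitivity. -/
theorem Persistent.dia_know {φ : Formula P} (h : Persistent φ) : Persistent (dia (know φ)) := by
  intro s t hst
  constructor
  · intro hs
    obtain ⟨u, hu, hk⟩ := World.mem_dia.1 hs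
    exact dia_mem_of_dia_box_mem hst
      (World.mem_dia.2 ⟨u, hu, World.mem_box.2 fun v hv => h.know_mem hv hk⟩)
  · intro ht
    obtain ⟨u, hu, hk⟩ := World.mem_dia.1 ht
    exact World.mem_dia.2 ⟨u, hst.trans hu, hk⟩

theorem know_dia_know_mem {φ : Formula P} {s : World P} (hs : know φ ∈ s.1) :
    know (dia (know φ)) ∈ s.1 :=
  World.mem_know.2 fun t ht => World.mem_dia.2 ⟨t, .refl t, World.mem_know.2 fun _ hu =>
    (ht.trans hu) _ hs⟩

theorem Persistent.dia_know_and {φ ψ : Formula P} (hφ : Persistent φ) (hψ : Persistent ψ)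
    {s : World P} (h : dia (know φ) ∈ s.1) (h' : dia (know ψ) ∈ s.1) :
    dia (know (Formula.and φ ψ)) ∈ s.1 := by
  obtain ⟨t, ht, hk⟩ := World.mem_dia.1 h
  obtain ⟨u, hu, hk'⟩ := World.mem_dia.1 ((hψ.dia_know ht).1 h')
  refine World.mem_dia.2 ⟨u, ht.trans hu, World.mem_know.2 fun v hv => ?_⟩
  exact World.mem_and.2 ⟨hv _ (hφ.know_mem hu hk), hv _ hk'⟩

/-- Upward transfer of `L β` along `R_□` for persistent `β`. -/
theorem Persistent.poss_mem {φ : Formula P} (h : Persistent φ) {s t : World P} (hst : RBox s t)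
    (ht : poss φ ∈ t.1) : poss φ ∈ s.1 := by
  obtain ⟨u, hu, hφ⟩ := World.mem_poss.1 ht
  obtain ⟨v, hv, hvu⟩ := hst.cross hu
  exact World.mem_poss.2 ⟨v, hv, (h hvu).2 hφ⟩

/-- The union axiom, iterated: finitely many possibilities can be realized below one world. -/
theorem exists_rBox_of_list {s : World P} {α : Formula P} (hα : Persistent α)
    (hs : dia (know α) ∈ s.1) (l : List (Formula P)) (hl : ∀ β ∈ l, Persistent β)
    (h : ∀ β ∈ l, poss (and (dia (know α)) β) ∈ s.1) :
    ∃ t, RBox s t ∧ know α ∈ t.1 ∧ ∀ β ∈ l, poss β ∈ t.1 := by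
  induction l with
  | nil =>
    obtain ⟨t, ht, hk⟩ := World.mem_dia.1 hs
    exact ⟨t, ht, hk, by simp⟩
  | cons β l ih =>
    obtain ⟨t, ht, hk, hlt⟩ := ih (fun γ hγ => hl γ (List.mem_cons_of_mem _ hγ))
      fun γ hγ => h γ (List.mem_cons_of_mem _ hγ)
    have h1 : dia (and (know α) (conj (l.map poss))) ∈ s.1 := World.mem_dia.2 ⟨t, ht, by
      simpa [hk] using hlt⟩
    obtain ⟨u, hu, hu'⟩ := World.mem_poss.1 (h β List.mem_cons_self)
    rw [World.mem_and] at hu'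
    obtain ⟨v, hv, hkv⟩ := World.mem_dia.1 hu'.1
    have hβ := hl β List.mem_cons_self
    have h2 : poss (dia (and (know α) β)) ∈ s.1 := World.mem_poss.2 ⟨u, hu, World.mem_dia.2
      ⟨v, hv, World.mem_and.2 ⟨hkv, (hβ hv).1 hu'.2⟩⟩⟩
    -- The possibilities already realized are bundled into the second formula of the union axiom; β
    -- is the third.
    have h3 := World.mem_imp.1 (s.mem_of_provable (.union α (conj (l.map poss)) β))
      (World.mem_and.2 ⟨h1, h2⟩)
    obtain ⟨w, hw, hw'⟩ := World.mem_dia.1 h3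
    simp only [World.mem_and] at hw'
    obtain ⟨⟨hw1, hw2⟩, hw3⟩ := hw'
    -- The axiom only delivers α, β and the bundle under ◇; persistence of the formulae removes the
    -- diamonds.
    refine ⟨w, hw, World.mem_know.2 fun z hz => ?_, List.forall_mem_cons.2 ⟨?_, fun γ hγ => ?_⟩⟩
    · obtain ⟨z', hz', hα'⟩ := World.mem_dia.1 (hz _ hw1)
      exact (hα hz').2 hα'
    · obtain ⟨z, hz, hz'⟩ := World.mem_poss.1 hw3
      obtain ⟨z', hz1, hz2⟩ := World.mem_dia.1 hz'
      exact World.mem_poss.2 ⟨z, hz, (hβ hz1).2 hz2⟩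
    · obtain ⟨z, hz, hz'⟩ := World.mem_dia.1 hw2
      exact (hl γ (List.mem_cons_of_mem _ hγ)).poss_mem hz
        (World.mem_conj.1 hz' _ (List.mem_map_of_mem hγ))

/-- Below `s` there is a world that knows all of `A` and deems every member of `N` possible. -/
theorem exists_rBox_know_poss (s : World P) {A N : Set (Formula P)}
    (hA : ∀ α ∈ A, Persistent α) (hN : ∀ β ∈ N, Persistent β) (htop : top ∈ A)
    (hand : ∀ α ∈ A, ∀ α' ∈ A, and α α' ∈ A) (h1 : ∀ α ∈ A, dia (know α) ∈ s.1)
    (h2 : ∀ α ∈ A, ∀ β ∈ N, poss (and (dia (know α)) β) ∈ s.1) :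
    ∃ t, RBox s t ∧ (∀ α ∈ A, know α ∈ t.1) ∧ ∀ β ∈ N, poss β ∈ t.1 := by
  -- Compactness: `D` consists of the consequences of finitely many of the demands, those on
  -- knowledge being merged into one α.
  obtain ⟨t, hst, ht⟩ := exists_rBox s (D := {φ | ∃ α ∈ A, ∃ l : List (Formula P),
      (∀ β ∈ l, β ∈ N) ∧ ∀ w : World P, know α ∈ w.1 → (∀ β ∈ l, poss β ∈ w.1) → φ ∈ w.1})
    ⟨top, htop, [], by simp, by simp⟩
    (by
      rintro φ ⟨α, hα, l, hl, h⟩ φ' ⟨α', hα', l', hl', h'⟩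
      refine ⟨and α α', hand _ hα _ hα', l ++ l', fun β hβ => ?_, fun w hw hw' => ?_⟩
      · rcases List.mem_append.1 hβ with hβ | hβ
        exacts [hl _ hβ, hl' _ hβ]
      · simp only [World.mem_know, World.mem_and] at hw ⊢
        exact ⟨h w (World.mem_know.2 fun t ht => (hw t ht).1) fun β hβ =>
            hw' _ (List.mem_append_left _ hβ),
          h' w (World.mem_know.2 fun t ht => (hw t ht).2) fun β hβ =>
            hw' _ (List.mem_append_right _ hβ)⟩)
    (by
      rintro φ ⟨α, hα, l, hl, h⟩
      obtain ⟨t, ht, hk, hp⟩ := exists_rBox_of_list (hA α hα) (h1 α hα) l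
        (fun β hβ => hN β (hl β hβ)) fun β hβ => h2 α hα β (hl β hβ)
      exact World.mem_dia.2 ⟨t, ht, h t hk hp⟩)
  exact ⟨t, hst, fun α hα => ht ⟨α, hα, [], by simp, fun w hw _ => hw⟩,
    fun β hβ => ht ⟨top, htop, [β], by simpa using hβ, fun w _ hw => hw β (by simp)⟩⟩

/-! ### Worlds are determined by their persistent knowledge -/

/-- Two worlds agree on persistent formulae and on knowledge of persistent formulae. -/
structure Agree (s t : World P) : Prop where
  iff : ∀ φ, Persistent φ → (φ ∈ s.1 ↔ φ ∈ t.1)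
  know_iff : ∀ φ, Persistent φ → (know φ ∈ s.1 ↔ know φ ∈ t.1)

theorem Agree.symm {s t : World P} (h : Agree s t) : Agree t s :=
  ⟨fun φ hφ => (h.iff φ hφ).symm, fun φ hφ => (h.know_iff φ hφ).symm⟩

theorem Persistent.poss_mem_of_know_iff {s t : World P}
    (h : ∀ φ, Persistent φ → know φ ∈ s.1 → know φ ∈ t.1) {φ : Formula P} (hφ : Persistent φ)
    (ht : poss φ ∈ t.1) : poss φ ∈ s.1 :=
  World.mem_neg.2 fun hk => World.mem_neg.1 ht (h _ hφ.neg hk)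

/-- If `t` agrees with `s` on persistent formulae and the persistent possibilities of `t` are
compatible with `s`, then some `R_□`-successor of `s` agrees with `t`. -/
theorem exists_rBox_agree {s t : World P} (h : ∀ φ, Persistent φ → (φ ∈ s.1 ↔ φ ∈ t.1))
    (hp : ∀ φ, Persistent φ → poss φ ∈ t.1 → poss φ ∈ s.1) : ∃ u, RBox s u ∧ Agree t u := by
  obtain ⟨u, hu, h1, h2⟩ := exists_rBox_know_poss s
    (A := {α | Persistent α ∧ know α ∈ t.1}) (N := {β | Persistent β ∧ poss β ∈ t.1})
    (fun α hα => hα.1) (fun β hβ => hβ.1) ⟨persistent_atom _, by simp [World.mem_know]⟩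
    (fun α hα α' hα' => ⟨hα.1.and hα'.1, World.mem_know.2 fun v hv =>
      World.mem_and.2 ⟨hv _ hα.2, hv _ hα'.2⟩⟩)
    (fun α hα => (h _ hα.1.dia_know).2 (World.mem_dia.2 ⟨t, .refl t, hα.2⟩))
    -- The formula ◇Kα ∧ β is persistent and possible at `t`, since Kα makes ◇Kα hold throughout the
    -- K-class of `t`.
    (fun α hα β hβ => by
      refine hp _ (hα.1.dia_know.and hβ.1) ?_
      obtain ⟨v, hv, hv'⟩ := World.mem_poss.1 hβ.2
      exact World.mem_poss.2 ⟨v, hv, World.mem_and.2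
        ⟨hv _ (know_dia_know_mem hα.2), hv'⟩⟩)
  refine ⟨u, hu, fun φ hφ => (h φ hφ).symm.trans (hφ hu), fun φ hφ =>
    ⟨fun hk => h1 φ ⟨hφ, hk⟩, fun hk => ?_⟩⟩
  by_contra hn
  obtain ⟨v, hv, hv'⟩ := World.mem_poss.1 (h2 (neg φ) ⟨hφ.neg, by
    rw [World.mem_poss]
    simp only [World.mem_know, not_forall] at hn
    obtain ⟨v, hv, hv'⟩ := hn
    exact ⟨v, hv, World.mem_neg.2 hv'⟩⟩)
  exact World.mem_neg.1 hv' (hv _ hk)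

theorem exists_rKnow_persistent {s t : World P}
    (h : ∀ φ, Persistent φ → know φ ∈ s.1 → φ ∈ t.1) :
    ∃ u, RKnow s u ∧ ∀ φ, Persistent φ → (φ ∈ t.1 ↔ φ ∈ u.1) := by
  obtain ⟨u, hu, h1⟩ := exists_rKnow s (D := {φ | Persistent φ ∧ φ ∈ t.1})
    ⟨persistent_atom _, t.top_mem⟩
    (fun φ hφ ψ hψ => ⟨hφ.1.and hψ.1, World.mem_and.2 ⟨hφ.2, hψ.2⟩⟩)
    (fun φ hφ => World.mem_neg.2 fun hk => World.mem_neg.1 (h _ hφ.1.neg hk) hφ.2)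
  refine ⟨u, hu, fun φ hφ => ⟨fun hk => h1 ⟨hφ, hk⟩, fun hk => ?_⟩⟩
  by_contra hn
  exact World.mem_neg.1 (h1 ⟨hφ.neg, World.mem_neg.2 hn⟩) hk

theorem RKnow.know_iff {s t : World P} (h : RKnow s t) (φ : Formula P) :
    know φ ∈ s.1 ↔ know φ ∈ t.1 := by
  simp only [World.mem_know]
  exact ⟨fun h' u hu => h' u (h.trans hu), fun h' u hu => h' u (h.symm.trans hu)⟩

/-- `Agree` is a bisimulation: `exists_rBox_agree` matches □-steps and `exists_rKnow_persistent`
matches K-steps. -/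
theorem Agree.mem_iff (φ : Formula P) {s t : World P} (h : Agree s t) : φ ∈ s.1 ↔ φ ∈ t.1 := by
  induction φ generalizing s t with
  | atom A => exact h.iff _ (persistent_atom A)
  | and φ ψ ihφ ihψ => rw [World.mem_and, World.mem_and, ihφ h, ihψ h]
  | neg φ ih => rw [World.mem_neg, World.mem_neg, ih h]
  | box φ ih =>
    have : ∀ {s t : World P}, Agree s t → box φ ∈ s.1 → box φ ∈ t.1 := by
      refine fun {s t} h hs => World.mem_box.2 fun u hu => ?_
      obtain ⟨v, hv, hv'⟩ := exists_rBox_agree (s := s) (t := u)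
        (fun ψ hψ => (h.iff ψ hψ).trans (hψ hu))
        (fun ψ hψ hp => Persistent.poss_mem_of_know_iff (fun χ hχ => (h.know_iff χ hχ).1) hψ
          (hψ.poss_mem hu hp))
      exact (ih hv').2 (hv _ hs)
    exact ⟨this h, this h.symm⟩
  | know φ ih =>
    have : ∀ {s t : World P}, Agree s t → know φ ∈ s.1 → know φ ∈ t.1 := by
      refine fun {s t} h hs => World.mem_know.2 fun u hu => ?_
      obtain ⟨v, hv, hv'⟩ := exists_rKnow_persistent (s := s) (t := u)
        (fun ψ hψ hk => hu _ ((h.know_iff ψ hψ).1 hk))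
      have : Agree u v := ⟨hv', fun ψ hψ => by
        rw [← hu.know_iff, ← hv.know_iff, h.know_iff ψ hψ]⟩
      exact (ih this).2 (hv _ hs)
    exact ⟨this h, this h.symm⟩

theorem Agree.eq {s t : World P} (h : Agree s t) : s = t :=
  Subtype.ext (Set.ext fun φ => h.mem_iff φ)

/-! ### Ending points -/

/-- Take a successor `e` that knows every persistent formula which `s` can come to know. Successors
of `e` can know nothing more of this kind, so they agree with `e` and equal it. -/
theorem exists_isEndingPoint (s : World P) :
    ∃ e, IsEndingPoint s e ∧ ∀ t, RBox e t → t = e := by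
  obtain ⟨e, he, h1, -⟩ := exists_rBox_know_poss s
    (A := {α | Persistent α ∧ dia (know α) ∈ s.1}) (N := ∅)
    (fun α hα => hα.1) (by simp) ⟨persistent_atom _, World.mem_dia.2 ⟨s, .refl s, by
      simp [World.mem_know]⟩⟩
    (fun α hα α' hα' => ⟨hα.1.and hα'.1, hα.1.dia_know_and hα'.1 hα.2 hα'.2⟩)
    (fun α hα => hα.2) (by simp)
  have hdead : ∀ t, RBox e t → t = e := fun t ht => Agree.eq
    ⟨fun φ hφ => (hφ ht).symm, fun φ hφ => ⟨fun hk => h1 φ ⟨hφ, World.mem_dia.2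
      ⟨t, he.trans ht, hk⟩⟩, hφ.know_mem ht⟩⟩
  refine ⟨e, fun s' hs' φ hφ => ?_, hdead⟩
  -- From □φ at `s'` follows ◇□φ at `s`, hence ◇φ at `e`, whose only successor is itself.
  obtain ⟨t, ht, hφt⟩ := World.mem_dia.1 (dia_mem_of_dia_box_mem he
    (World.mem_dia.2 ⟨s', hs', hφ⟩))
  exact hdead t ht ▸ hφt

theorem IsEndingPoint.rBox {s e : World P} (h : IsEndingPoint s e) : RBox s e := h s (.refl s)

theorem IsEndingPoint.eq_of_rBox {s e t : World P} (h : IsEndingPoint s e) (ht : RBox e t) :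
    t = e := by
  obtain ⟨e', he', hd⟩ := exists_isEndingPoint s
  obtain rfl := hd e (h e' he'.rBox)
  exact hd t ht

theorem IsEndingPoint.unique {s e e' : World P} (h : IsEndingPoint s e)
    (h' : IsEndingPoint s e') : e' = e := h.eq_of_rBox (h' e h.rBox)

/-- The ending point of a world, as a point of the canonical topology. -/
noncomputable def World.endpoint (s : World P) : CanonicalPoint P :=
  ⟨(exists_isEndingPoint s).choose, s, (exists_isEndingPoint s).choose_spec.1⟩

theorem World.isEndingPoint_endpoint (s : World P) : IsEndingPoint s s.endpoint.1 :=
  (exists_isEndingPoint s).choose_spec.1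

theorem isEndingPoint_iff {s : World P} {x : CanonicalPoint P} :
    IsEndingPoint s x.1 ↔ s.endpoint = x :=
  ⟨fun h => Subtype.ext (h.unique s.isEndingPoint_endpoint),
    fun h => h ▸ s.isEndingPoint_endpoint⟩

theorem RBox.endpoint_eq {s t : World P} (h : RBox s t) : t.endpoint = s.endpoint :=
  isEndingPoint_iff.1 fun _ hu => s.isEndingPoint_endpoint _ (h.trans hu)

theorem CanonicalPoint.eq_of_rBox (x : CanonicalPoint P) {t : World P} (h : RBox x.1 t) :
    t = x.1 := x.2.choose_spec.eq_of_rBox h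

theorem CanonicalPoint.endpoint_eq (x : CanonicalPoint P) : x.1.endpoint = x :=
  isEndingPoint_iff.1 fun _ ht => x.eq_of_rBox ht ▸ .refl _

theorem Persistent.mem_endpoint {φ : Formula P} (h : Persistent φ) (s : World P) :
    φ ∈ s.endpoint.1.1 ↔ φ ∈ s.1 := (h s.isEndingPoint_endpoint.rBox).symm

theorem CanonicalPoint.dia_mem {x : CanonicalPoint P} {φ : Formula P} :
    dia φ ∈ x.1.1 ↔ φ ∈ x.1.1 := by
  refine ⟨fun h => ?_, fun h => World.mem_dia.2 ⟨_, .refl _, h⟩⟩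
  obtain ⟨t, ht, h⟩ := World.mem_dia.1 h
  exact x.eq_of_rBox ht ▸ h

/-- At an ending point Kφ is equivalent to ◇Kφ, which is persistent for persistent φ; so knowledge
adds no information. -/
theorem CanonicalPoint.ext {x y : CanonicalPoint P}
    (h : ∀ φ, Persistent φ → (φ ∈ x.1.1 ↔ φ ∈ y.1.1)) : x = y :=
  Subtype.ext <| Agree.eq ⟨h, fun φ hφ => by
    rw [← dia_mem (x := x), ← dia_mem (x := y), h _ hφ.dia_know]⟩

/-! ### The canonical sets -/

theorem mem_canonicalSet_iff_exists {s : World P} {x : CanonicalPoint P} :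
    x ∈ canonicalSet s ↔ ∃ t, RKnow s t ∧ t.endpoint = x := by
  simp only [canonicalSet, Set.mem_ofPred_eq, isEndingPoint_iff]
  exact exists_congr fun t => and_congr_left fun _ => ⟨.symm, .symm⟩

/-- The canonical set is cut out by the persistent formulae known at `s`, so it is closed in the
sense of `Saturated.mem`. -/
theorem mem_canonicalSet {s : World P} {x : CanonicalPoint P} :
    x ∈ canonicalSet s ↔ ∀ φ, Persistent φ → know φ ∈ s.1 → φ ∈ x.1.1 := by
  rw [mem_canonicalSet_iff_exists]
  constructor
  · rintro ⟨t, ht, rfl⟩ φ hφ hk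
    exact (hφ.mem_endpoint t).2 (ht _ hk)
  · intro h
    obtain ⟨t, ht, h'⟩ := exists_rKnow_persistent h
    exact ⟨t, ht, CanonicalPoint.ext fun φ hφ => by rw [hφ.mem_endpoint, h' φ hφ]⟩

theorem World.endpoint_mem_canonicalSet (s : World P) : s.endpoint ∈ canonicalSet s :=
  mem_canonicalSet_iff_exists.2 ⟨s, .refl s, rfl⟩

theorem canonicalSet_mem (s : World P) : canonicalSet s ∈ canonicalTopology P := .inr ⟨s, rfl⟩

theorem RKnow.canonicalSet_eq {s t : World P} (h : RKnow s t) :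
    canonicalSet s = canonicalSet t := by
  ext x
  simp only [mem_canonicalSet, h.know_iff]

theorem RBox.canonicalSet_subset {s t : World P} (h : RBox s t) :
    canonicalSet t ⊆ canonicalSet s := by
  intro x hx
  rw [mem_canonicalSet] at hx ⊢
  exact fun φ hφ hk => hx φ hφ (hφ.know_mem h hk)

theorem Persistent.know_mem_iff {φ : Formula P} (hφ : Persistent φ) {s : World P} :
    know φ ∈ s.1 ↔ ∀ x ∈ canonicalSet s, φ ∈ x.1.1 := by
  refine ⟨fun h x hx => mem_canonicalSet.1 hx φ hφ h, fun h => World.mem_know.2 fun t ht => ?_⟩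
  exact (hφ.mem_endpoint t).1 (h _ (mem_canonicalSet_iff_exists.2 ⟨t, ht, rfl⟩))

theorem World.ext_endpoint {s t : World P} (h : s.endpoint = t.endpoint)
    (h' : canonicalSet s = canonicalSet t) : s = t :=
  Agree.eq ⟨fun φ hφ => by rw [← hφ.mem_endpoint, h, hφ.mem_endpoint], fun φ hφ => by
    rw [hφ.know_mem_iff, h', hφ.know_mem_iff]⟩

theorem rBox_iff {s t : World P} :
    RBox s t ↔ t.endpoint = s.endpoint ∧ canonicalSet t ⊆ canonicalSet s := by
  refine ⟨fun h => ⟨h.endpoint_eq, h.canonicalSet_subset⟩, fun ⟨h, h'⟩ => ?_⟩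
  obtain ⟨u, hu, ha⟩ := exists_rBox_agree (s := s) (t := t)
    (fun φ hφ => by rw [← hφ.mem_endpoint, ← h, hφ.mem_endpoint])
    (fun φ hφ => Persistent.poss_mem_of_know_iff (fun ψ hψ hk =>
      hψ.know_mem_iff.2 fun x hx => hψ.know_mem_iff.1 hk x (h' hx)) hφ)
  exact ha.eq ▸ hu

theorem exists_world_of_mem {U : Set (CanonicalPoint P)} (hU : U ∈ canonicalTopology P)
    {x : CanonicalPoint P} (hx : x ∈ U) : ∃ s : World P, s.endpoint = x ∧ canonicalSet s = U := by
  rcases hU with rfl | ⟨s, rfl⟩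
  · exact hx.elim
  · obtain ⟨t, ht, h⟩ := mem_canonicalSet_iff_exists.1 hx
    exact ⟨t, h, ht.canonicalSet_eq.symm⟩

/-- The truth lemma for the canonical subset model. -/
theorem sat_endpoint_iff (φ : Formula P) (s : World P) :
    Sat (canonicalTopology P) (canonicalInterp P) φ s.endpoint (canonicalSet s) ↔ φ ∈ s.1 := by
  induction φ generalizing s with
  | atom A => exact (persistent_atom A).mem_endpoint s
  | and φ ψ ihφ ihψ => rw [Sat, ihφ, ihψ, World.mem_and]
  | neg φ ih => rw [Sat, ih, World.mem_neg]
  | box φ ih =>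
    rw [Sat, World.mem_box]
    constructor
    · intro h t ht
      rw [← ih, ht.endpoint_eq]
      exact h _ (canonicalSet_mem t) ht.canonicalSet_subset
        (ht.endpoint_eq ▸ t.endpoint_mem_canonicalSet)
    · intro h V hV hVs hx
      obtain ⟨t, ht, rfl⟩ := exists_world_of_mem hV hx
      rw [← ht, ih]
      exact h t (rBox_iff.2 ⟨ht, hVs⟩)
  | know φ ih =>
    rw [Sat, World.mem_know]
    constructor
    · intro h t ht
      rw [← ih, ← ht.canonicalSet_eq]
      exact h _ (mem_canonicalSet_iff_exists.2 ⟨t, ht, rfl⟩)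
    · intro h y hy
      obtain ⟨t, ht, rfl⟩ := mem_canonicalSet_iff_exists.1 hy
      rw [ht.canonicalSet_eq, ih]
      exact h t ht

/-! ### Saturated sets -/

/-- A set of points that is closed in the topology generated by the persistent formulae and
contains the canonical set of each of its points. -/
structure Saturated (V : Set (CanonicalPoint P)) : Prop where
  mem : ∀ x, (∀ φ, Persistent φ → (∀ y ∈ V, φ ∈ y.1.1) → φ ∈ x.1.1) → x ∈ V
  subset : ∀ x ∈ V, canonicalSet x.1 ⊆ V

theorem saturated_canonicalSet (s : World P) : Saturated (canonicalSet s) where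
  mem x hx := mem_canonicalSet.2 fun φ hφ hk => hx φ hφ (hφ.know_mem_iff.1 hk)
  subset x hx := by
    obtain ⟨t, ht, rfl⟩ := mem_canonicalSet_iff_exists.1 hx
    rw [ht.canonicalSet_eq]
    exact t.isEndingPoint_endpoint.rBox.canonicalSet_subset

theorem saturated_of_mem {V : Set (CanonicalPoint P)} (h : V ∈ canonicalTopology P) :
    Saturated V := by
  rcases h with rfl | ⟨s, rfl⟩
  · exact ⟨fun x hx => (x.1.bot_notMem (hx bot (persistent_atom _) (by simp))).elim, by simp⟩
  · exact saturated_canonicalSet s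

theorem Saturated.union {V W : Set (CanonicalPoint P)} (hV : Saturated V) (hW : Saturated W) :
    Saturated (V ∪ W) where
  -- A point outside both sets fails some φ valid on `V` and some ψ valid on `W`, hence the
  -- persistent formula φ ∨ ψ.
  mem x hx := by
    by_contra hn
    have h1 := mt (hV.mem x) fun h => hn (.inl h)
    have h2 := mt (hW.mem x) fun h => hn (.inr h)
    push Not at h1 h2
    obtain ⟨φ, hφ, h1, h1'⟩ := h1
    obtain ⟨ψ, hψ, h2, h2'⟩ := h2
    rcases World.mem_or.1 (hx _ (hφ.or hψ) (by
      rintro y (hy | hy)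
      exacts [World.mem_or.2 (.inl (h1 y hy)), World.mem_or.2 (.inr (h2 y hy))])) with h | h
    exacts [h1' h, h2' h]
  subset x hx := by
    rcases hx with hx | hx
    exacts [(hV.subset x hx).trans Set.subset_union_left,
      (hW.subset x hx).trans Set.subset_union_right]

theorem Saturated.sInter {A : Set (Set (CanonicalPoint P))} (h : ∀ V ∈ A, Saturated V) :
    Saturated (⋂₀ A) where
  mem x hx V hV := (h V hV).mem x fun φ hφ hφV => hx φ hφ fun y hy => hφV y (hy V hV)
  subset x hx _ hy V hV := (h V hV).subset x (hx V hV) hy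

theorem Saturated.inter {V W : Set (CanonicalPoint P)} (hV : Saturated V) (hW : Saturated W) :
    Saturated (V ∩ W) := by
  rw [← Set.sInter_pair]
  exact .sInter (by simp [hV, hW])

/-- Saturated sets below a canonical set are canonical. -/
theorem Saturated.mem_canonicalTopology {V : Set (CanonicalPoint P)} (hV : Saturated V)
    {s : World P} (hs : V ⊆ canonicalSet s) : V ∈ canonicalTopology P := by
  rcases V.eq_empty_or_nonempty with rfl | ⟨x, hx⟩
  · exact .inl rfl
  right
  obtain ⟨t, ht, htx⟩ := mem_canonicalSet_iff_exists.1 (hs hx)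
  have hdia : ∀ α, Persistent α → (∀ y ∈ V, α ∈ y.1.1) → ∀ y ∈ V, dia (know α) ∈ y.1.1 :=
    fun α hp hα y hy => World.mem_dia.2 ⟨_, .refl _, hp.know_mem_iff.2 fun z hz =>
      hα z (hV.subset y hy hz)⟩
  -- The world `u` should know exactly the persistent formulae valid on `V`: `A` forces these, and
  -- `N` excludes the others by keeping their negations possible.
  obtain ⟨u, hu, h1, h2⟩ := exists_rBox_know_poss t
    (A := {α | Persistent α ∧ ∀ y ∈ V, α ∈ y.1.1})
    (N := {β | Persistent β ∧ ∃ y ∈ V, β ∈ y.1.1}) (fun α hα => hα.1) (fun β hβ => hβ.1)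
    ⟨persistent_atom _, fun _ _ => World.top_mem _⟩
    (fun α hα α' hα' => ⟨hα.1.and hα'.1, fun y hy => World.mem_and.2 ⟨hα.2 y hy, hα'.2 y hy⟩⟩)
    (fun α hα => by
      rw [← hα.1.dia_know.mem_endpoint, htx]
      exact hdia α hα.1 hα.2 x hx)
    (fun α hα β ⟨hβ, y, hy, hy'⟩ => by
      obtain ⟨v, hv, hvy⟩ := mem_canonicalSet_iff_exists.1 (hs hy)
      refine World.mem_poss.2 ⟨v, ht.symm.trans hv, ?_⟩
      rw [← (hα.1.dia_know.and hβ).mem_endpoint, hvy, World.mem_and]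
      exact ⟨hdia α hα.1 hα.2 y hy, hy'⟩)
  refine ⟨u, Set.ext fun y => ?_⟩
  rw [mem_canonicalSet]
  refine ⟨fun hy φ hφ hk => ?_, fun hy => hV.mem y fun φ hφ hφV => hy φ hφ (h1 φ ⟨hφ, hφV⟩)⟩
  by_contra hn
  obtain ⟨v, hv, hv'⟩ := World.mem_poss.1 (h2 (neg φ) ⟨hφ.neg, y, hy, World.mem_neg.2 hn⟩)
  exact World.mem_neg.1 hv' (hv _ hk)

/-! ### Soundness for subset spaces with bounded unions and intersections -/

section Soundness

variable {X : Type*} {𝒪 : Set (Set X)} {i : Atom P → Set X}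

theorem Sat.isPropVal (htop : i .top = Set.univ) (hbot : i .bot = ∅) (x : X) (U : Set X) :
    IsPropVal fun φ => Sat 𝒪 i φ x U where
  top := by simp [Formula.top, Sat, htop]
  bot := by simp [Formula.bot, Sat, hbot]
  neg _ := Iff.rfl
  and _ _ := Iff.rfl

/-- Soundness of `MP*` for families of sets that are closed under bounded binary unions and
intersections. -/
theorem Provable.sat (htop : i .top = Set.univ) (hbot : i .bot = ∅)
    (hunion : ∀ U ∈ 𝒪, ∀ V ∈ 𝒪, ∀ W ∈ 𝒪, V ⊆ U → W ⊆ U → V ∪ W ∈ 𝒪)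
    (hinter : ∀ U ∈ 𝒪, ∀ V ∈ 𝒪, ∀ W ∈ 𝒪, V ⊆ U → W ⊆ U → V ∩ W ∈ 𝒪)
    {φ : Formula P} (h : Provable φ) {x : X} {U : Set X} (hU : U ∈ 𝒪) (hx : x ∈ U) :
    Sat 𝒪 i φ x U := by
  have hv := Sat.isPropVal (𝒪 := 𝒪) htop hbot
  have imp_iff : ∀ φ ψ x U, Sat 𝒪 i (imp φ ψ) x U ↔ (Sat 𝒪 i φ x U → Sat 𝒪 i ψ x U) :=
    fun φ ψ x U => (hv x U).imp φ ψ
  have dia_iff : ∀ φ x U, Sat 𝒪 i (dia φ) x U ↔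
      ∃ V ∈ 𝒪, V ⊆ U ∧ x ∈ V ∧ Sat 𝒪 i φ x V := fun φ x U => by
    simp only [dia, Sat]; push Not; rfl
  have poss_iff : ∀ φ x U, Sat 𝒪 i (poss φ) x U ↔ ∃ y ∈ U, Sat 𝒪 i φ y U := fun φ x U => by
    simp only [poss, Sat]; push Not; rfl
  induction h generalizing x U with
  | taut φ h => exact h _ (hv x U)
  | atomPersistent A =>
    refine ((hv x U).and _ _).2 ⟨?_, ?_⟩ <;> rw [imp_iff] <;> exact fun h V _ _ _ => h
  | boxDistr φ ψ =>
    simp only [imp_iff, Sat]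
    exact fun h h' V hV hVU hxV => h V hV hVU hxV (h' V hV hVU hxV)
  | boxT φ =>
    simp only [imp_iff, Sat]
    exact fun h => h U hU subset_rfl hx
  | boxFour φ =>
    simp only [imp_iff, Sat]
    exact fun h V _ hVU _ W hW hWV => h W hW (hWV.trans hVU)
  | knowDistr φ ψ =>
    simp only [imp_iff, Sat]
    exact fun h h' y hy => h y hy (h' y hy)
  | knowT φ =>
    simp only [imp_iff, Sat]
    exact fun h => h x hx
  | knowFour φ =>
    simp only [imp_iff, Sat]
    exact fun h _ _ => h
  | knowB φ =>
    simp only [imp_iff, Sat, poss_iff]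
    exact fun h _ _ => ⟨x, hx, h⟩
  | knowBox φ =>
    simp only [imp_iff, Sat]
    exact fun h V hV hVU _ y hy => h y (hVU hy) V hV hVU hy
  | diaBox φ =>
    simp only [imp_iff, Sat, dia_iff]
    rintro ⟨V, hV, hVU, hxV, h⟩ W hW hWU hxW
    have hVW := hinter U hU V hV W hW hVU hWU
    exact ⟨V ∩ W, hVW, Set.inter_subset_right, ⟨hxV, hxW⟩,
      h _ hVW Set.inter_subset_left ⟨hxV, hxW⟩⟩
  | union φ ψ χ =>
    simp only [imp_iff, Sat, dia_iff, poss_iff]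
    rintro ⟨⟨V, hV, hVU, hxV, hφV, hψ⟩, y, hy, W, hW, hWU, hyW, hφW, hχ⟩
    refine ⟨V ∪ W, hunion U hU V hV W hW hVU hWU, Set.union_subset hVU hWU, .inl hxV,
      ⟨?_, V, hV, Set.subset_union_left, hxV, hψ⟩, y, .inr hyW, W, hW, Set.subset_union_right,
      hyW, hχ⟩
    rintro z (hz | hz)
    · exact ⟨V, hV, Set.subset_union_left, hz, hφV z hz⟩
    · exact ⟨W, hW, Set.subset_union_right, hz, hφW z hz⟩
  | mp φ ψ _ _ ih₁ ih₂ => exact (imp_iff _ _ _ _).1 (ih₁ hU hx) (ih₂ hU hx)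
  | knowNec φ _ ih => exact fun y hy => ih hU hy
  | boxNec φ _ ih => exact fun V hV _ hxV => ih hV hxV

end Soundness

/-- Supplies the bounded closure conditions for soundness before the whole space is known to be
canonical. -/
theorem canonicalTopology_bounded {U V : Set (CanonicalPoint P)} (hU : U ∈ canonicalTopology P)
    (hV : Saturated V) (hVU : V ⊆ U) : V ∈ canonicalTopology P := by
  rcases hU with rfl | ⟨s, rfl⟩
  · exact .inl (Set.subset_empty_iff.1 hVU)
  · exact hV.mem_canonicalTopology hVU

/-! ### The sum of copies of the canonical subset model -/

variable (P) in
/-- Sets of pairs, all of whose fibres belong to the canonical topology. -/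
def sumTopology : Set (Set (World P × CanonicalPoint P)) :=
  {W | ∀ s, Prod.mk s ⁻¹' W ∈ canonicalTopology P}

variable (P) in
/-- The interpretation of the atoms on pairs by their second component. -/
def sumInterp (A : Atom P) : Set (World P × CanonicalPoint P) := {p | atom A ∈ p.2.1.1}

theorem Provable.sat_sum {φ : Formula P} (h : Provable φ) {p : World P × CanonicalPoint P}
    {W : Set (World P × CanonicalPoint P)} (hW : W ∈ sumTopology P) (hp : p ∈ W) :
    Sat (sumTopology P) (sumInterp P) φ p W := by
  refine h.sat (Set.eq_univ_of_forall fun p => p.2.1.top_mem)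
    (Set.eq_empty_of_forall_notMem fun p => p.2.1.bot_notMem) ?_ ?_ hW hp
  · intro U hU V hV W hW hVU hWU s
    exact canonicalTopology_bounded (hU s)
      ((saturated_of_mem (hV s)).union (saturated_of_mem (hW s)))
      (Set.preimage_mono (Set.union_subset hVU hWU))
  · intro U hU V hV W hW hVU hWU s
    exact canonicalTopology_bounded (hU s)
      ((saturated_of_mem (hV s)).inter (saturated_of_mem (hW s)))
      (Set.preimage_mono (Set.inter_subset_left.trans hVU))

theorem image_mk_mem_sumTopology (s : World P) {V : Set (CanonicalPoint P)}
    (hV : V ∈ canonicalTopology P) : Prod.mk s '' V ∈ sumTopology P := by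
  intro t
  by_cases h : s = t
  · subst h
    rwa [Set.preimage_image_eq _ (Prod.mk_right_injective s)]
  · left
    ext x
    simp [h]

/-- Satisfaction on one summand of the sum model. -/
theorem sat_sum_iff (φ : Formula P) (s : World P) (x : CanonicalPoint P)
    (V : Set (CanonicalPoint P)) :
    Sat (sumTopology P) (sumInterp P) φ (s, x) (Prod.mk s '' V) ↔
      Sat (canonicalTopology P) (canonicalInterp P) φ x V := by
  induction φ generalizing x V with
  | atom A => rfl
  | and φ ψ ihφ ihψ => rw [Sat, Sat, ihφ, ihψ]
  | neg φ ih => rw [Sat, Sat, ih]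
  | know φ ih => simp [Sat, ih]
  | box φ ih =>
    rw [Sat, Sat]
    constructor
    · intro h W hW hWV hx
      exact (ih _ _).1 (h _ (image_mk_mem_sumTopology s hW) (Set.image_mono hWV)
        (Set.mem_image_of_mem _ hx))
    · intro h W hW hWV hx
      have hWs : Prod.mk s '' (Prod.mk s ⁻¹' W) = W :=
        Set.image_preimage_eq_of_subset (hWV.trans (Set.image_subset_range _ _))
      rw [← hWs, ih]
      refine h _ (hW s) (fun y hy => ?_) hx
      simpa using hWV hy

/-- In the sum model, a persistent formula is evaluated at the second component. -/
theorem Persistent.sat_sum_iff {φ : Formula P} (hφ : Persistent φ) {s : World P}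
    {x : CanonicalPoint P} {W : Set (World P × CanonicalPoint P)} (hW : W ∈ sumTopology P)
    (hx : (s, x) ∈ W) : Sat (sumTopology P) (sumInterp P) φ (s, x) W ↔ φ ∈ x.1.1 := by
  have key : ∀ ψ : Formula P, Persistent ψ → Sat (sumTopology P) (sumInterp P) ψ (s, x) W →
      ψ ∈ x.1.1 := by
    intro ψ hψ h
    -- Completeness turns persistence into a theorem, and soundness transports it to the sum. There
    -- □ allows `W` to be shrunk to its fibre over `s`, where the truth lemma applies.
    have hp : Provable (imp ψ (box ψ)) := provable_iff_forall_mem.2 fun t => World.mem_imp.2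
      fun ht => World.mem_box.2 fun u hu => (hψ hu).1 ht
    have himp := not_and_not_right.1 (hp.sat_sum hW hx) h
    obtain ⟨t, rfl, ht⟩ := exists_world_of_mem (hW s) hx
    have h1 := himp _ (image_mk_mem_sumTopology s (hW s)) (Set.image_preimage_subset _ _)
      (Set.mem_image_of_mem _ hx)
    rw [MPStar.sat_sum_iff, ← ht, sat_endpoint_iff] at h1
    exact (hψ.mem_endpoint t).2 h1
  refine ⟨key φ hφ, fun h => ?_⟩
  by_contra hn
  exact World.mem_neg.1 (key _ hφ.neg hn) h

/-- Some world knows only those persistent formulae that are theorems. -/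
theorem exists_canonicalSet_eq_univ (s₀ : World P) :
    ∃ s : World P, canonicalSet s = Set.univ := by
  let W : Set (World P × CanonicalPoint P) := {p | p.2 ∈ canonicalSet p.1}
  have hW : W ∈ sumTopology P := canonicalSet_mem
  have hp : (s₀, s₀.endpoint) ∈ W := s₀.endpoint_mem_canonicalSet
  -- The world sought is the theory of one pair in `W`; what it knows holds at all pairs of `W`.
  refine ⟨.ofPropVal (Sat.isPropVal (𝒪 := sumTopology P) (i := sumInterp P)
    (Set.eq_univ_of_forall fun p => p.2.1.top_mem)
    (Set.eq_empty_of_forall_notMem fun p => p.2.1.bot_notMem) (s₀, s₀.endpoint) W)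
    fun φ h => h.sat_sum hW hp, Set.eq_univ_of_forall fun x => mem_canonicalSet.2
    fun φ hφ (hk : ∀ q ∈ W, Sat (sumTopology P) (sumInterp P) φ q W) => ?_⟩
  -- An ending point is its own ending point, so `x` occurs in the fibre over the world `x.1`.
  have hx : (x.1, x) ∈ W := by
    have := x.1.endpoint_mem_canonicalSet
    rwa [x.endpoint_eq] at this
  exact (hφ.sat_sum_iff hW hx).1 (hk _ hx)

theorem mem_canonicalTopology_iff {V : Set (CanonicalPoint P)} :
    V ∈ canonicalTopology P ↔ Saturated V := by
  refine ⟨saturated_of_mem, fun h => ?_⟩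
  rcases V.eq_empty_or_nonempty with rfl | ⟨x, -⟩
  · exact .inl rfl
  · obtain ⟨s, hs⟩ := exists_canonicalSet_eq_univ x.1
    exact h.mem_canonicalTopology (s := s) (hs ▸ Set.subset_univ _)

/-! ### Worlds, pointed pairs and ultrafilters -/

variable (P) in
/-- A world corresponds to its ending point together with its canonical set. -/
noncomputable def worldEquivPointed : World P ≃ PointedProduct (canonicalTopology P) :=
  .ofBijective (fun s => ⟨(s.endpoint, canonicalSet s), canonicalSet_mem s,
    s.endpoint_mem_canonicalSet⟩)
    ⟨fun _ _ h => World.ext_endpoint (congrArg (·.1.1) h) (congrArg (·.1.2) h), fun p => by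
      obtain ⟨s, h1, h2⟩ := exists_world_of_mem p.2.1 p.2.2
      exact ⟨s, Subtype.ext (Prod.ext h1 h2)⟩⟩

theorem worldEquivPointed_symm_mem (p : PointedProduct (canonicalTopology P)) (φ : Formula P) :
    φ ∈ ((worldEquivPointed P).symm p).1 ↔
      Sat (canonicalTopology P) (canonicalInterp P) φ p.1.1 p.1.2 := by
  obtain ⟨s, rfl⟩ := (worldEquivPointed P).surjective p
  rw [Equiv.symm_apply_apply]
  exact (sat_endpoint_iff φ s).symm

/-- The filter of the Lindenbaum algebra given by a world. -/
def World.filter (s : World P) : Order.PFilter (Lindenbaum P) :=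
  Order.IsPFilter.toPFilter (F := Lindenbaum.mk '' s.1) <| .of_def
    ⟨_, Set.mem_image_of_mem _ s.top_mem⟩
    (by
      rintro _ ⟨φ, hφ, rfl⟩ _ ⟨ψ, hψ, rfl⟩
      exact ⟨_, ⟨and φ ψ, World.mem_and.2 ⟨hφ, hψ⟩, rfl⟩,
        inf_le_left (a := Lindenbaum.mk φ) (b := Lindenbaum.mk ψ),
        inf_le_right (a := Lindenbaum.mk φ) (b := Lindenbaum.mk ψ)⟩)
    (by
      rintro _ b hb ⟨φ, hφ, rfl⟩
      induction b using Lindenbaum.ind with | h ψ =>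
      exact ⟨ψ, World.mem_imp.1 (s.mem_of_provable hb) hφ, rfl⟩)

theorem World.mk_mem_filter {s : World P} {φ : Formula P} :
    Lindenbaum.mk φ ∈ s.filter ↔ φ ∈ s.1 := by
  refine ⟨?_, fun h => ⟨φ, h, rfl⟩⟩
  rintro ⟨ψ, hψ, h⟩
  exact mem_imp.1 (s.mem_of_provable (Lindenbaum.mk_eq_mk.1 h).1) hψ

/-- If neither `a` nor `aᶜ` belonged to `F`, the filter generated by `F` and `a` would be proper and
strictly larger. -/
theorem _root_.Order.PFilter.compl_mem_of_maximal {B : Type*} [BooleanAlgebra B]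
    {F : Order.PFilter B} (hF : Maximal (fun G : Order.PFilter B => ⊥ ∉ G) F) {a : B}
    (ha : a ∉ F) : aᶜ ∈ F := by
  by_contra hn
  let G : Order.PFilter B := Order.IsPFilter.toPFilter (F := {b | ∃ f ∈ F, f ⊓ a ≤ b}) <| .of_def
    ⟨⊤, ⊤, F.top_mem, le_top⟩
    (by
      rintro b ⟨f, hf, h⟩ c ⟨g, hg, h'⟩
      exact ⟨f ⊓ g ⊓ a, ⟨f ⊓ g, F.inf_mem hf hg, le_rfl⟩,
        (inf_le_inf_right a inf_le_left).trans h, (inf_le_inf_right a inf_le_right).trans h'⟩)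
    (by
      rintro b c hbc ⟨f, hf, h⟩
      exact ⟨f, hf, h.trans hbc⟩)
  have hG : ⊥ ∉ G := by
    rintro ⟨f, hf, h⟩
    exact hn (F.mem_of_le (le_compl_iff_disjoint_right.2 (disjoint_iff_inf_le.2 h)) hf)
  exact ha (hF.2 hG (fun b hb => ⟨b, hb, inf_le_left⟩) ⟨⊤, F.top_mem, inf_le_right⟩)

theorem World.maximal_filter (s : World P) :
    Maximal (fun G : Order.PFilter (Lindenbaum P) => ⊥ ∉ G) s.filter := by
  refine ⟨fun h => s.bot_notMem (mk_mem_filter.1 h), fun G hG hle a ha => ?_⟩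
  induction a using Lindenbaum.ind with | h φ =>
  rw [mk_mem_filter]
  by_contra hn
  have h : (Lindenbaum.mk φ)ᶜ ∈ G := hle (mk_mem_filter.2 (mem_neg.2 hn))
  have := G.inf_mem ha h
  rw [inf_compl_eq_bot] at this
  exact hG this

variable (P) in
/-- Members of the canonical model are the same as ultrafilters of the Lindenbaum algebra. -/
noncomputable def worldEquivUltrafilter : World P ≃ BoolUltrafilter (Lindenbaum P) :=
  .ofBijective (fun s => ⟨s.filter, s.maximal_filter⟩)
    ⟨fun s t h => World.eq_of_subset fun φ hφ => by
      have h' : s.filter = t.filter := congrArg Subtype.val h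
      rw [← World.mk_mem_filter, ← h']
      exact World.mk_mem_filter.2 hφ, fun F => by
      have hF := F.2
      have hv : IsPropVal fun φ : Formula P => Lindenbaum.mk φ ∈ F.1 :=
        { top := F.1.top_mem
          bot := hF.1
          neg := fun φ => by
            refine ⟨fun h h' => hF.1 ?_, Order.PFilter.compl_mem_of_maximal hF⟩
            have := F.1.inf_mem h' (show (Lindenbaum.mk φ)ᶜ ∈ F.1 from h)
            rwa [inf_compl_eq_bot] at this
          and := fun φ ψ => Order.PFilter.inf_mem_iff (x := Lindenbaum.mk φ)
            (y := Lindenbaum.mk ψ) }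
      refine ⟨World.ofPropVal hv fun φ hφ => F.1.mem_of_le (Lindenbaum.mk_le_mk.2
        (hφ.of_taut fun v hv h => (hv.imp top φ).2 fun _ => h)) F.1.top_mem, Subtype.ext ?_⟩
      refine SetLike.ext fun a => ?_
      induction a using Lindenbaum.ind with | h φ =>
      exact World.mk_mem_filter⟩

end MPStar

/-! ### The closed topology and the composite bijection -/

theorem mainTheorem12 (P : Type*) [Countable P] :
    -- the family of the canonical closed sets is the family of closed sets of a topology
    (∃ τ : TopologicalSpace (MPStar.CanonicalPoint P),
      ∀ U : Set (MPStar.CanonicalPoint P), @IsClosed _ τ U ↔ U ∈ MPStar.canonicalTopology P) ∧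
    -- and `(x, U) ↦ {[φ] : x, U ⊨ φ}` is a bijection from its pointed product to the ultrafilters
    (∃ Φ : MPStar.PointedProduct (MPStar.canonicalTopology P) ≃
        MPStar.BoolUltrafilter (MPStar.Lindenbaum P),
      ∀ (p : MPStar.PointedProduct (MPStar.canonicalTopology P)) (φ : MPStar.Formula P),
        MPStar.Lindenbaum.mk φ ∈ (Φ p).1 ↔
          MPStar.Sat (MPStar.canonicalTopology P) (MPStar.canonicalInterp P) φ p.1.1 p.1.2) := by
  refine ⟨⟨.ofClosed (MPStar.canonicalTopology P) (.inl rfl) ?_ ?_, fun U => ?_⟩,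
    (MPStar.worldEquivPointed P).symm.trans (MPStar.worldEquivUltrafilter P), fun p φ => ?_⟩
  · exact fun A hA => MPStar.mem_canonicalTopology_iff.2 (.sInter fun V hV =>
      MPStar.saturated_of_mem (hA hV))
  · exact fun V hV W hW => MPStar.mem_canonicalTopology_iff.2
      ((MPStar.saturated_of_mem hV).union (MPStar.saturated_of_mem hW))
  · rw [← @isOpen_compl_iff]
    change Uᶜᶜ ∈ _ ↔ _
    rw [compl_compl]
  · rw [← MPStar.worldEquivPointed_symm_mem]
    exact MPStar.World.mk_mem_filter
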